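/- Let $r\ge 1$, and let $\boldsymbol m=(m_1,\dots,m_r)$, $\boldsymbol l=(l_1,\dots,l_r)$ and $k$ be non-negative integers that are consistent, i.e. with $l_0=k$ and $l_{r+1}=0$, $$k\ge l_1\ge l_2\ge\dots\ge l_r\ge 0,\qquad l_s-l_{s+1}\le m_s\quad(s=1,\dots,r).$$ Put $e_i=k+\sum_{s=1}^i m_s-l_i+l_{i+1}+i$ for $i=0,\dots,r$, and $T_1=(x-1)^kx^{m_1}$, $T_i=x^{m_i}$ for $2\le i\le r$. There is a unique complex vector space $V=V(\boldsymbol m,\boldsymbol l,k)$ of dimension $r+1$ of polynomials in $\mathbb C[x]$ such that the set of orders of zero of the nonzero elements of $V$ is $\{\,i+\sum_{s=1}^i m_s : 0\le i\le r\}$ at $x=0$, is $\{0,k+1,k+2,\dots,k+r\}$ at $x=1$, and is $\{0,1,\dots,r\}$ at every other point of $\mathbb C$, and such that the set of degrees of the nonzero elements of $V$ is $\{e_0,\dots,e_r\}$. Let $f_1,\dots,f_{r+1}$ be a basis of $V$ with $\deg f_{i+1}=e_i$ for $i=0,\dots,r$, and let $W(f_1,\dots,f_i)$ denote the Wronskian.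 For $i=1,\dots,r$ let $y_i=y_i(\boldsymbol m,\boldsymbol l,k)$ be the monic constant multiple of $$W(f_1,\dots,f_i)\,T_1^{1-i}\,T_2^{2-i}\cdots T_{i-1}^{-1}.$$ These $y_i$ are well defined: they are polynomials and do not depend on the choice of the basis. Moreover $$y_1(1)\ne 0,\qquad y_i(0)\ne 0\quad(i=1,\dots,r).$$ Hence $y_i$ and $T_i$ are relatively prime for every $i=1,\dots,r$. -/

import Mathlib

open Polynomial

noncomputable section

/-- The sequence `l_0 = k, l_1, …, l_r, l_{r+1} = 0` (all later terms are `0` as well). The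
sequences `(l_1, …, l_r)` and `(m_1, …, m_r)` are functions on `Fin r`, so that `l_{j+1}` is
`l j` and `m_{j+1}` is `m j`. -/
def extL {r : ℕ} (l : Fin r → ℕ) (k : ℕ) : ℕ → ℕ
  | 0 => k
  | j + 1 => if h : j < r then l ⟨j, h⟩ else 0

/-- Consistent parameters: `k ≥ l_1 ≥ … ≥ l_r ≥ 0` and `l_s - l_{s+1} ≤ m_s` for `1 ≤ s ≤ r`. -/
def Consistent {r : ℕ} (m l : Fin r → ℕ) (k : ℕ) : Prop :=
  (∀ s : Fin r, extL l k (s + 1) ≤ extL l k s) ∧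
  (∀ s : Fin r, extL l k (s + 1) ≤ m s + extL l k (s + 2))

/-- The partial sum `n_1 + … + n_i`. -/
def psum {r : ℕ} (n : Fin r → ℕ) (i : ℕ) : ℕ :=
  ∑ s : Fin r, if (s : ℕ) < i then n s else 0

/-- The set `{0, 1 + n_1, 2 + n_1 + n_2, …, r + n_1 + … + n_r}`. -/
def exponentSet {r : ℕ} (n : Fin r → ℕ) : Set ℕ :=
  Set.range fun i : Fin (r + 1) => (i : ℕ) + psum n i

/-- The set of orders of zero at `z` of the nonzero elements of `V`. -/
def exponentsAt (V : Submodule ℂ ℂ[X]) (z : ℂ) : Set ℕ :=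
  {d | ∃ f ∈ V, f ≠ 0 ∧ f.rootMultiplicity z = d}

/-- The set of degrees of the nonzero elements of `V`. -/
def exponentsAtInfinity (V : Submodule ℂ ℂ[X]) : Set ℕ :=
  {d | ∃ f ∈ V, f ≠ 0 ∧ f.natDegree = d}

/-- `d = e_i = k + m_1 + … + m_i - l_i + l_{i+1} + i`, written without subtraction. -/
def IsDegreeExponent {r : ℕ} (m l : Fin r → ℕ) (k : ℕ) (i d : ℕ) : Prop :=
  d + extL l k i = k + psum m i + extL l k (i + 1) + i

/-- The numbers `n_1(z), …, n_r(z)`: `n(0) = (m_1, …, m_r)`, `n(1) = (k, 0, …, 0)`, and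
`n(z) = (0, …, 0)`, that is, `z` is not a singular point, at all other points `z`. -/
def localData {r : ℕ} (m : Fin r → ℕ) (k : ℕ) (z : ℂ) : Fin r → ℕ :=
  open Classical in
  if z = 0 then m
  else if z = 1 then fun s => if (s : ℕ) = 0 then k else 0
  else fun _ => 0

/-- `V` is an `(r+1)`-dimensional space of polynomials, without singular points outside `{0, 1}`,
whose exponents at `0`, `1` and infinity are those prescribed by the parameters. The absence of
base points is contained in the second field, since `0` is an exponent at every point. -/
structure IsSpaceV {r : ℕ} (m l : Fin r → ℕ) (k : ℕ) (V : Submodule ℂ ℂ[X]) : Prop where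
  finrank_eq : Module.finrank ℂ V = r + 1
  exponents : ∀ z : ℂ, exponentsAt V z = exponentSet (localData m k z)
  exponents_infinity : exponentsAtInfinity V = {d | ∃ i ≤ r, IsDegreeExponent m l k i d}

/-- The polynomials `T_1 = (x-1)^k x^{m_1}` and `T_i = x^{m_i}` for `i = 2, …, r`. -/
def polyT {r : ℕ} (m : Fin r → ℕ) (k : ℕ) (i : Fin r) : ℂ[X] :=
  if (i : ℕ) = 0 then (X - 1) ^ k * X ^ m i else X ^ m i

/-- The Wronskian `det (f_j^{(i)})` of polynomials `f_1, …, f_n`. -/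
def polyWronskian {n : ℕ} (f : Fin n → ℂ[X]) : ℂ[X] :=
  Matrix.det (Matrix.of fun i j : Fin n => derivative^[(i : ℕ)] (f j))

/-- `g` is a divided Wronskian `W(f_1, …, f_i) T_1^{1-i} T_2^{2-i} ⋯ T_{i-1}^{-1}`, multiplied
by a nonzero constant; here `i` is `p + 1` and `T_{j+1}` is `polyT m k j`. -/
def IsDividedWronskianMultiple {r : ℕ} (m : Fin r → ℕ) (k : ℕ) {p : ℕ}
    (f : Fin (p + 1) → ℂ[X]) (g : ℂ[X]) : Prop :=
  ∃ c : ℂ, c ≠ 0 ∧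
    g * (∏ j : Fin r, if (j : ℕ) < p then polyT m k j ^ (p - (j : ℕ)) else 1) =
      C c * polyWronskian f

/-- `y = (y_1, …, y_r)` is the tuple of monic polynomials proportional to the divided Wronskians
of the initial segments of a basis `f_1, …, f_{r+1}` of `V` that is compatible with the flag of
`V` at infinity, that is, `deg f_{i+1} = e_i` for `i = 0, …, r`. -/
def IsTupleOf {r : ℕ} (m l : Fin r → ℕ) (k : ℕ) (V : Submodule ℂ ℂ[X])
    (y : Fin r → ℂ[X]) : Prop :=
  ∃ f : Module.Basis (Fin (r + 1)) ℂ V,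
    (∀ i : Fin (r + 1), IsDegreeExponent m l k i (f i : ℂ[X]).natDegree) ∧
    ∀ i : Fin r, (y i).Monic ∧
      IsDividedWronskianMultiple m k
        (fun j : Fin ((i : ℕ) + 1) => (f (Fin.castLE (by omega) j) : ℂ[X])) (y i)

end

open Polynomial

noncomputable section

/-! ### Wronskians of polynomials -/

/-! Let a_i and e_i be the exponents at 0 and at infinity, and d_i = l_i - l_{i+1}. The condition at
1 says that V becomes a line modulo (X-1)^(k+1), spanned by the class of a polynomial nonzero at 1.
A dimension count puts into V, for each i, a nonzero X^{a_i} q_i with deg q_i ≤ e_i - a_i = k - d_i.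

The map `hilbertTransform k` has the multiples of (X-1)^(k+1) as kernel and turns multiplication by
X into the shift R(X) ↦ R(X-1). Hence these elements, suitably scaled, share one image R of degree
at most k, and the bound on deg q_i forces R to vanish at a_i - 1, …, a_i - d_i. Consistency makes
these blocks disjoint, and they contain k points in all, so R is a multiple of `gapPoly`. This
determines V (`IsSpaceV.eq_span`). Conversely, inverting the transform gives polynomials h_i of
order exactly a_i and degree exactly e_i (`exists_flag_poly`); a degree count for their Wronskian
yields the exponents at all other points.

The basis h_0, …, h_r is thus adapted to the flags at 0 and at infinity simultaneously. So W(h_0, …,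
h_p) vanishes at 0 to exactly the order removed by the T_i (`IsFlagBasis.polyWronskian_segment`),
and y_1 is proportional to h_0, which is nonzero at 1. -/

lemma coeff_X_pow_mul_iterate_derivative (f : ℂ[X]) (i n : ℕ) :
    (X ^ i * derivative^[i] f).coeff n = n.descFactorial i * f.coeff n := by
  rw [coeff_X_pow_mul']
  split_ifs with h
  · rw [coeff_iterate_derivative, Nat.sub_add_cancel h, nsmul_eq_mul]
  · rw [Nat.descFactorial_of_lt (by omega)]
    simp

/-- Scaling row i by X^i replaces derivatives by operators diagonal on monomials, so degrees and
orders can be read off column by column. -/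
lemma X_pow_mul_polyWronskian {n : ℕ} (f : Fin n → ℂ[X]) :
    X ^ (∑ i : Fin n, (i : ℕ)) * polyWronskian f =
      Matrix.det (Matrix.of fun i j : Fin n => X ^ (i : ℕ) * derivative^[(i : ℕ)] (f j)) := by
  rw [polyWronskian, ← Finset.prod_pow_eq_pow_sum, ← Matrix.det_mul_column]
  rfl

/-- The descending factorials are values of monic polynomials of degree i, so the determinant is a
Vandermonde determinant. -/
lemma det_descFactorial_ne_zero {n : ℕ} {d : Fin n → ℕ} (hd : Function.Injective d) :
    Matrix.det (Matrix.of fun i j : Fin n => ((d j).descFactorial i : ℂ)) ≠ 0 := by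
  have h := Matrix.det_eval_matrixOfPolynomials_eq_det_vandermonde (fun i => (d i : ℂ))
    (fun j : Fin n => descPochhammer ℂ j) (fun i => descPochhammer_natDegree ℂ _)
    (fun i => monic_descPochhammer ℂ _)
  have hv : (Matrix.vandermonde fun i => (d i : ℂ)).det ≠ 0 :=
    Matrix.det_vandermonde_ne_zero_iff.2 fun i j hij => hd (by exact_mod_cast hij)
  rw [h, ← Matrix.det_transpose] at hv
  convert hv using 3
  ext i j
  simp [descPochhammer_eval_eq_descFactorial]

lemma coeff_prod_sum_of_natDegree_le {ι : Type*} (s : Finset ι) (f : ι → ℂ[X]) (e : ι → ℕ)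
    (h : ∀ i ∈ s, (f i).natDegree ≤ e i) :
    (∏ i ∈ s, f i).coeff (∑ i ∈ s, e i) = ∏ i ∈ s, (f i).coeff (e i) := by
  classical
  induction s using Finset.induction_on with
  | empty => simp
  | insert a s ha ih =>
    rw [Finset.prod_insert ha, Finset.sum_insert ha, Finset.prod_insert ha,
      coeff_mul_add_eq_of_natDegree_le (h a (by simp)), ih fun i hi => h i (by simp [hi])]
    exact (natDegree_prod_le _ _).trans (Finset.sum_le_sum fun i hi => h i (by simp [hi]))

lemma natDegree_det_le {n : ℕ} (M : Matrix (Fin n) (Fin n) ℂ[X]) (e : Fin n → ℕ)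
    (h : ∀ i j, (M i j).natDegree ≤ e j) : M.det.natDegree ≤ ∑ j, e j := by
  rw [Matrix.det_apply]
  refine natDegree_sum_le_of_forall_le _ _ fun σ _ => ?_
  refine (natDegree_smul_le _ _).trans ((natDegree_prod_le _ _).trans ?_)
  exact Finset.sum_le_sum fun i _ => h _ _

lemma coeff_det_sum {n : ℕ} (M : Matrix (Fin n) (Fin n) ℂ[X]) (e : Fin n → ℕ)
    (h : ∀ i j, (M i j).natDegree ≤ e j) :
    M.det.coeff (∑ j, e j) = Matrix.det (Matrix.of fun i j => (M i j).coeff (e j)) := by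
  rw [Matrix.det_apply, Matrix.det_apply, finsetSum_coeff]
  refine Finset.sum_congr rfl fun σ _ => ?_
  rw [Units.smul_def, Units.smul_def, coeff_smul,
    coeff_prod_sum_of_natDegree_le _ _ _ fun i _ => h _ _]
  rfl

lemma det_coeff_iterate_derivative_ne_zero {n : ℕ} (f : Fin n → ℂ[X]) (d : Fin n → ℕ)
    (hd : Function.Injective d) (hf : ∀ j, (f j).coeff (d j) ≠ 0) :
    Matrix.det (Matrix.of fun i j : Fin n =>
      (X ^ (i : ℕ) * derivative^[(i : ℕ)] (f j)).coeff (d j)) ≠ 0 := by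
  have : (Matrix.of fun i j : Fin n =>
      (X ^ (i : ℕ) * derivative^[(i : ℕ)] (f j)).coeff (d j)) =
      Matrix.of fun i j : Fin n => (f j).coeff (d j) *
        (Matrix.of fun i j : Fin n => ((d j).descFactorial i : ℂ)) i j := by
    ext i j
    simp only [Matrix.of_apply, coeff_X_pow_mul_iterate_derivative, mul_comm]
  rw [this, Matrix.det_mul_row]
  exact mul_ne_zero (Finset.prod_ne_zero_iff.2 fun j _ => hf j) (det_descFactorial_ne_zero hd)

/-- The coefficient in the expected top degree is the product of the leading coefficients times a
Vandermonde determinant, hence nonzero. -/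
lemma polyWronskian_of_natDegree {n : ℕ} (f : Fin n → ℂ[X]) (hf : ∀ j, f j ≠ 0)
    (hd : Function.Injective fun j => (f j).natDegree) :
    polyWronskian f ≠ 0 ∧
      (polyWronskian f).natDegree + ∑ i : Fin n, (i : ℕ) = ∑ j, (f j).natDegree := by
  have hle : ∀ i j : Fin n, ((Matrix.of fun i j : Fin n =>
      X ^ (i : ℕ) * derivative^[(i : ℕ)] (f j)) i j).natDegree ≤ (f j).natDegree := by
    intro i j
    refine natDegree_le_iff_coeff_eq_zero.2 fun N hN => ?_
    rw [Matrix.of_apply, coeff_X_pow_mul_iterate_derivative, coeff_eq_zero_of_natDegree_lt hN,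
      mul_zero]
  have hc := coeff_det_sum _ _ hle
  have hl := natDegree_det_le _ _ hle
  have hne := det_coeff_iterate_derivative_ne_zero f _ hd fun j => by
    simpa using hf j
  simp only [Matrix.of_apply] at hc
  rw [← hc, ← X_pow_mul_polyWronskian] at hne
  rw [← X_pow_mul_polyWronskian] at hl
  have hw : polyWronskian f ≠ 0 := by
    rintro h
    simp [h] at hne
  refine ⟨hw, ?_⟩
  have := le_antisymm hl (le_natDegree_of_ne_zero hne)
  rwa [natDegree_X_pow_mul _ hw] at this

/-- Mirror image of the degree statement: after a power of X is pulled out of each column, the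
constant term is again a nonzero Vandermonde multiple. -/
lemma polyWronskian_of_rootMultiplicity_zero {n : ℕ} (f : Fin n → ℂ[X]) (hf : ∀ j, f j ≠ 0)
    (hd : Function.Injective fun j => (f j).rootMultiplicity 0) :
    polyWronskian f ≠ 0 ∧ (polyWronskian f).rootMultiplicity 0 + ∑ i : Fin n, (i : ℕ) =
      ∑ j, (f j).rootMultiplicity 0 := by
  simp only [rootMultiplicity_eq_natTrailingDegree'] at hd ⊢
  have hdvd : ∀ i j : Fin n,
      X ^ (f j).natTrailingDegree ∣ X ^ (i : ℕ) * derivative^[(i : ℕ)] (f j) := by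
    intro i j
    refine X_pow_dvd_iff.2 fun N hN => ?_
    rw [coeff_X_pow_mul_iterate_derivative, coeff_eq_zero_of_lt_natTrailingDegree hN, mul_zero]
  choose Q hQ using hdvd
  have hne := det_coeff_iterate_derivative_ne_zero f _ hd fun j => by
    simpa using hf j
  simp only [hQ, coeff_X_pow_mul', le_refl, if_true, Nat.sub_self] at hne
  have hX : X ^ (∑ i : Fin n, (i : ℕ)) * polyWronskian f =
      X ^ (∑ j, (f j).natTrailingDegree) * Matrix.det (Matrix.of Q) := by
    rw [X_pow_mul_polyWronskian, ← Finset.prod_pow_eq_pow_sum, ← Matrix.det_mul_row]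
    simp only [hQ, Matrix.of_apply]
  have h0 : (Matrix.det (Matrix.of Q)).coeff 0 ≠ 0 := by
    rw [← constantCoeff_apply, RingHom.map_det]
    exact hne
  have hQ0 : Matrix.det (Matrix.of Q) ≠ 0 := by
    rintro h
    simp [h] at h0
  have hw : polyWronskian f ≠ 0 := by
    rintro h
    rw [h, mul_zero] at hX
    exact mul_ne_zero (pow_ne_zero _ X_ne_zero) hQ0 hX.symm
  refine ⟨hw, ?_⟩
  have := congrArg natTrailingDegree hX
  rw [natTrailingDegree_mul (pow_ne_zero _ X_ne_zero) hw,
    natTrailingDegree_mul (pow_ne_zero _ X_ne_zero) hQ0, natTrailingDegree_X_pow,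
    natTrailingDegree_X_pow, natTrailingDegree_eq_zero.2 (Or.inr h0)] at this
  omega

lemma taylor_derivative_iterate (z : ℂ) (f : ℂ[X]) (i : ℕ) :
    derivative^[i] (taylor z f) = taylor z (derivative^[i] f) := by
  induction i generalizing f with
  | zero => rfl
  | succ i ih =>
    rw [Function.iterate_succ_apply, Function.iterate_succ_apply, ← ih]
    congr 1
    simp [taylor_apply, derivative_comp]

lemma polyWronskian_taylor {n : ℕ} (z : ℂ) (f : Fin n → ℂ[X]) :
    polyWronskian (fun j => taylor z (f j)) = taylor z (polyWronskian f) := by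
  have : taylor z (polyWronskian f) = taylorAlgHom z (polyWronskian f) := rfl
  rw [this, polyWronskian, polyWronskian, AlgHom.map_det]
  congr 1
  ext1 i j
  simp [taylor_derivative_iterate]

lemma rootMultiplicity_taylor (z : ℂ) (f : ℂ[X]) :
    (taylor z f).rootMultiplicity 0 = f.rootMultiplicity z := by
  rw [rootMultiplicity_eq_rootMultiplicity (p := f), taylor_apply]

lemma polyWronskian_of_rootMultiplicity {n : ℕ} (z : ℂ) (f : Fin n → ℂ[X]) (hf : ∀ j, f j ≠ 0)
    (hd : Function.Injective fun j => (f j).rootMultiplicity z) :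
    polyWronskian f ≠ 0 ∧ (polyWronskian f).rootMultiplicity z + ∑ i : Fin n, (i : ℕ) =
      ∑ j, (f j).rootMultiplicity z := by
  have h := polyWronskian_of_rootMultiplicity_zero (fun j => taylor z (f j))
    (fun j => by simpa using hf j) (by simpa only [rootMultiplicity_taylor] using hd)
  rw [polyWronskian_taylor, rootMultiplicity_taylor] at h
  simpa only [rootMultiplicity_taylor, ne_eq, taylor_eq_zero] using h

lemma linearIndependent_of_polyWronskian_ne_zero {n : ℕ} {f : Fin n → ℂ[X]}
    (h : polyWronskian f ≠ 0) : LinearIndependent ℂ f := by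
  rw [Fintype.linearIndependent_iff]
  intro c hc
  by_contra! hne
  obtain ⟨i, hi⟩ := hne
  refine h (Matrix.exists_mulVec_eq_zero_iff.1 ⟨fun j => C (c j), ?_, ?_⟩)
  · intro h0
    exact hi (C_eq_zero.1 (congrFun h0 i))
  · ext1 i
    have := congrArg (derivative^[(i : ℕ)]) hc
    rw [iterate_derivative_sum, iterate_derivative_zero] at this
    simp only [iterate_derivative_smul] at this
    simp only [smul_eq_C_mul] at this
    simpa [Matrix.mulVec, dotProduct, mul_comm] using this

lemma polyWronskian_linearCombination {n : ℕ} (f g : Fin n → ℂ[X])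
    (A : Matrix (Fin n) (Fin n) ℂ) (h : ∀ j, g j = ∑ i, A i j • f i) :
    polyWronskian g = C A.det * polyWronskian f := by
  rw [polyWronskian, polyWronskian, RingHom.map_det, mul_comm, ← Matrix.det_mul]
  congr 1
  ext1 i j
  simp only [Matrix.of_apply, h, iterate_derivative_sum, iterate_derivative_smul]
  simp [Matrix.mul_apply, smul_eq_C_mul, mul_comm]

/-! ### Exponents of spaces of polynomials -/

lemma exists_polyWronskian_eq_C_mul {n : ℕ} {f g : Fin n → ℂ[X]}
    (h : ∀ j, g j ∈ Submodule.span ℂ (Set.range f)) :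
    ∃ c : ℂ, polyWronskian g = C c * polyWronskian f := by
  simp only [Submodule.mem_span_range_iff_exists_fun] at h
  choose A hA using h
  exact ⟨_, polyWronskian_linearCombination f g (Matrix.of fun i j => A j i) fun j =>
    (hA j).symm⟩

lemma card_le_of_linearIndependent_mem {V : Submodule ℂ ℂ[X]} [FiniteDimensional ℂ V] {n : ℕ}
    {f : Fin n → ℂ[X]} (hf : LinearIndependent ℂ f) (h : ∀ j, f j ∈ V) :
    n ≤ Module.finrank ℂ V := by
  have : LinearIndependent ℂ fun j => (⟨f j, h j⟩ : V) :=
    LinearIndependent.of_comp V.subtype hf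
  simpa using this.fintype_card_le_finrank

lemma card_le_finrank_of_subset_exponentsAtInfinity {V : Submodule ℂ ℂ[X]}
    [FiniteDimensional ℂ V] {T : Finset ℕ} (hT : (T : Set ℕ) ⊆ exponentsAtInfinity V) :
    T.card ≤ Module.finrank ℂ V := by
  have h : ∀ j : Fin T.card, ∃ f ∈ V, f ≠ 0 ∧ f.natDegree = T.orderEmbOfFin rfl j :=
    fun j => hT (T.orderEmbOfFin_mem rfl j)
  choose f hfV hf0 hfd using h
  refine card_le_of_linearIndependent_mem (linearIndependent_of_polyWronskian_ne_zero
    (polyWronskian_of_natDegree f hf0 ?_).1) hfV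
  simp only [hfd]
  exact (T.orderEmbOfFin rfl).injective

lemma card_le_finrank_of_subset_exponentsAt {V : Submodule ℂ ℂ[X]}
    [FiniteDimensional ℂ V] {z : ℂ} {T : Finset ℕ} (hT : (T : Set ℕ) ⊆ exponentsAt V z) :
    T.card ≤ Module.finrank ℂ V := by
  have h : ∀ j : Fin T.card, ∃ f ∈ V, f ≠ 0 ∧ f.rootMultiplicity z = T.orderEmbOfFin rfl j :=
    fun j => hT (T.orderEmbOfFin_mem rfl j)
  choose f hfV hf0 hfd using h
  refine card_le_of_linearIndependent_mem (linearIndependent_of_polyWronskian_ne_zero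
    (polyWronskian_of_rootMultiplicity z f hf0 ?_).1) hfV
  simp only [hfd]
  exact (T.orderEmbOfFin rfl).injective

lemma finite_of_card_le {S : Set ℕ} {n : ℕ}
    (h : ∀ T : Finset ℕ, (T : Set ℕ) ⊆ S → T.card ≤ n) : S.Finite := by
  by_contra hS
  obtain ⟨T, hT, hc⟩ := Set.Infinite.exists_subset_card_eq hS (n + 1)
  have := h T hT
  omega

lemma finite_exponentsAt (V : Submodule ℂ ℂ[X]) [FiniteDimensional ℂ V] (z : ℂ) :
    (exponentsAt V z).Finite :=
  finite_of_card_le fun _ hT => card_le_finrank_of_subset_exponentsAt hT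

/-- Distinct orders give independent elements. Conversely, the Taylor coefficients at z indexed by
the exponents separate V, because the lowest nonzero coefficient of an element sits at its order. -/
lemma card_exponentsAt (V : Submodule ℂ ℂ[X]) [FiniteDimensional ℂ V] (z : ℂ) :
    (finite_exponentsAt V z).toFinset.card = Module.finrank ℂ V := by
  refine le_antisymm (card_le_finrank_of_subset_exponentsAt (z := z) (by simp)) ?_
  set S := (finite_exponentsAt V z).toFinset with hS
  let φ : V →ₗ[ℂ] (S → ℂ) :=
    LinearMap.pi fun s => (lcoeff ℂ (s : ℕ)) ∘ₗ (taylor z) ∘ₗ V.subtype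
  have hφ : Function.Injective φ := by
    rw [← LinearMap.ker_eq_bot, LinearMap.ker_eq_bot']
    intro f hf
    by_contra h0
    have h0' : (f : ℂ[X]) ≠ 0 := by simpa using h0
    have hm : (f : ℂ[X]).rootMultiplicity z ∈ S := by
      rw [hS, Set.Finite.mem_toFinset]
      exact ⟨f, f.2, h0', rfl⟩
    have : (taylor z (f : ℂ[X])).coeff ((f : ℂ[X]).rootMultiplicity z) = 0 :=
      congrFun hf ⟨_, hm⟩
    rw [← rootMultiplicity_taylor, rootMultiplicity_eq_natTrailingDegree',
      coeff_natTrailingDegree_eq_zero, taylor_eq_zero] at this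
    exact h0' this
  simpa using LinearMap.finrank_le_finrank_of_injective hφ

/-- A basis of the span with distinct orders at z has the same Wronskian up to a constant, so the
order of the Wronskian measures the sum of the exponents. -/
lemma exists_exponents {n : ℕ} {f : Fin n → ℂ[X]} (hf : LinearIndependent ℂ f) (z : ℂ) :
    ∃ d : Fin n → ℕ, StrictMono d ∧
      exponentsAt (Submodule.span ℂ (Set.range f)) z = Set.range d ∧
      polyWronskian f ≠ 0 ∧
      (polyWronskian f).rootMultiplicity z + ∑ i : Fin n, (i : ℕ) = ∑ j, d j := by
  have : FiniteDimensional ℂ (Submodule.span ℂ (Set.range f)) :=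
    FiniteDimensional.span_of_finite ℂ (Set.finite_range f)
  have hfin := finite_exponentsAt (Submodule.span ℂ (Set.range f)) z
  have hcard : hfin.toFinset.card = n := by
    rw [card_exponentsAt, finrank_span_eq_card hf, Fintype.card_fin]
  have hr : exponentsAt (Submodule.span ℂ (Set.range f)) z =
      Set.range (hfin.toFinset.orderEmbOfFin hcard) := by
    simp
  refine ⟨hfin.toFinset.orderEmbOfFin hcard, OrderEmbedding.strictMono _, hr, ?_⟩
  have h : ∀ j : Fin n, ∃ g ∈ Submodule.span ℂ (Set.range f), g ≠ 0 ∧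
      g.rootMultiplicity z = hfin.toFinset.orderEmbOfFin hcard j := fun j => by
    have : hfin.toFinset.orderEmbOfFin hcard j ∈
        exponentsAt (Submodule.span ℂ (Set.range f)) z :=
      hr.symm.subset (Set.mem_range_self j)
    exact this
  choose g hgV hg0 hgd using h
  obtain ⟨hw, hws⟩ := polyWronskian_of_rootMultiplicity z g hg0 (by
    simp only [hgd]
    exact (hfin.toFinset.orderEmbOfFin hcard).injective)
  obtain ⟨c, hc⟩ := exists_polyWronskian_eq_C_mul hgV
  have hw' := hw
  rw [hc] at hw'
  simp only [hgd] at hws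
  rw [hc, rootMultiplicity_mul hw', rootMultiplicity_C, zero_add] at hws
  exact ⟨right_ne_zero_of_mul hw', hws⟩

/-! ### The generating function transform

`hilbertTransform k p` is, up to the factor `k!`, the polynomial whose value at a large integer `n`
is the `n`-th coefficient of the power series `p / (1 - X) ^ (k + 1)`. -/

/-- The operator `R(X) ↦ R(X - 1)`. -/
def backwardShift : Module.End ℂ ℂ[X] := taylor (-1)

/-- The polynomial `(X + 1) ⋯ (X + k)`. -/
def risingProd (k : ℕ) : ℂ[X] := ∏ i ∈ Finset.range k, (X + C ((i : ℂ) + 1))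

/-- The polynomial `∑ p_j R(X - j)` where `R = (X + 1) ⋯ (X + k)`. -/
def hilbertTransform (k : ℕ) : ℂ[X] →ₗ[ℂ] ℂ[X] :=
  (LinearMap.applyₗ (risingProd k)).comp (aeval backwardShift).toLinearMap

lemma hilbertTransform_apply (k : ℕ) (p : ℂ[X]) :
    hilbertTransform k p = aeval backwardShift p (risingProd k) := rfl

lemma hilbertTransform_mul (k : ℕ) (p q : ℂ[X]) :
    hilbertTransform k (p * q) = aeval backwardShift p (hilbertTransform k q) := by
  simp [hilbertTransform_apply]

lemma eval_backwardShift_pow (R : ℂ[X]) (j : ℕ) (t : ℂ) :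
    ((backwardShift ^ j) R).eval t = R.eval (t - j) := by
  induction j generalizing t with
  | zero => simp
  | succ j ih =>
    rw [pow_succ', Module.End.mul_apply, backwardShift, taylor_eval, ← backwardShift, ih]
    congr 1
    push_cast
    ring

lemma eval_hilbertTransform_X_pow_mul (k a : ℕ) (q : ℂ[X]) (t : ℂ) :
    (hilbertTransform k (X ^ a * q)).eval t = (hilbertTransform k q).eval (t - a) := by
  rw [hilbertTransform_mul, map_pow, aeval_X, eval_backwardShift_pow]

lemma eval_hilbertTransform {k N : ℕ} {q : ℂ[X]} (hN : q.natDegree < N) (t : ℂ) :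
    (hilbertTransform k q).eval t =
      ∑ j ∈ Finset.range N, q.coeff j * (risingProd k).eval (t - j) := by
  rw [hilbertTransform_apply, aeval_eq_sum_range' hN, LinearMap.sum_apply, eval_finsetSum]
  simp [eval_backwardShift_pow]

lemma risingProd_eval_neg {k s : ℕ} (h1 : 1 ≤ s) (h2 : s ≤ k) :
    (risingProd k).eval (-(s : ℂ)) = 0 := by
  rw [risingProd, eval_prod]
  refine Finset.prod_eq_zero (i := s - 1) (by simp; omega) ?_
  simp [Nat.cast_sub h1]

lemma risingProd_eval_neg_succ_ne_zero (k : ℕ) : (risingProd k).eval (-((k : ℂ) + 1)) ≠ 0 := by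
  rw [risingProd, eval_prod, Finset.prod_ne_zero_iff]
  intro i hi h
  have : (i : ℂ) = k := by
    simp only [eval_add, eval_X, eval_C] at h
    linear_combination h
  have : i = k := by exact_mod_cast this
  simp [this] at hi

lemma natDegree_risingProd (k : ℕ) : (risingProd k).natDegree = k := by
  rw [risingProd, natDegree_prod_of_monic _ _ fun i _ => monic_X_add_C _]
  simp only [natDegree_X_add_C]
  simp

lemma natDegree_backwardShift_pow (R : ℂ[X]) (j : ℕ) :
    ((backwardShift ^ j) R).natDegree = R.natDegree := by
  induction j with
  | zero => simp
  | succ j ih => rw [pow_succ', Module.End.mul_apply, backwardShift, natDegree_taylor,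
      ← backwardShift, ih]

lemma natDegree_hilbertTransform_le (k : ℕ) (p : ℂ[X]) :
    (hilbertTransform k p).natDegree ≤ k := by
  rw [hilbertTransform_apply, aeval_eq_sum_range, LinearMap.sum_apply]
  refine natDegree_sum_le_of_forall_le _ _ fun j _ => ?_
  rw [LinearMap.smul_apply]
  refine (natDegree_smul_le _ _).trans ?_
  rw [natDegree_backwardShift_pow, natDegree_risingProd]

lemma degree_sub_backwardShift_lt {R : ℂ[X]} {n : ℕ} (h : R.degree < (n + 1 : ℕ)) :
    (R - backwardShift R).degree < n := by
  by_cases h0 : R = 0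
  · simp [h0]
  · refine (degree_sub_lt_left (degree_taylor R (-1)).symm h0
      (leadingCoeff_taylor (-1) R).symm).trans_le ?_
    rw [degree_eq_natDegree h0] at h ⊢
    have : R.natDegree < n + 1 := by exact_mod_cast h
    exact_mod_cast Nat.lt_succ_iff.1 this

/-- Multiplication by 1 - X becomes the backward difference, which lowers the degree by one. -/
lemma degree_hilbertTransform_one_sub_X_pow_mul {k j : ℕ} (hj : j ≤ k + 1) (p : ℂ[X]) :
    (hilbertTransform k ((1 - X) ^ j * p)).degree < (k + 1 - j : ℕ) := by
  induction j with
  | zero =>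
    rw [pow_zero, one_mul, Nat.sub_zero]
    exact lt_of_le_of_lt degree_le_natDegree
      (by exact_mod_cast Nat.lt_succ_of_le (natDegree_hilbertTransform_le k p))
  | succ j ih =>
    rw [pow_succ', mul_assoc, hilbertTransform_mul]
    simp only [map_sub, map_one, aeval_X, LinearMap.sub_apply, Module.End.one_apply]
    refine degree_sub_backwardShift_lt ?_
    rw [show k + 1 - (j + 1) + 1 = k + 1 - j by omega]
    exact ih (by omega)

lemma X_sub_one_pow_eq (j : ℕ) : (X - 1 : ℂ[X]) ^ j = C ((-1) ^ j) * (1 - X) ^ j := by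
  rw [← neg_sub, neg_pow]
  simp

lemma hilbertTransform_eq_zero_of_dvd {k : ℕ} {p : ℂ[X]} (h : (X - 1) ^ (k + 1) ∣ p) :
    hilbertTransform k p = 0 := by
  obtain ⟨g, rfl⟩ := h
  have := degree_hilbertTransform_one_sub_X_pow_mul (le_refl (k + 1)) (C ((-1) ^ (k + 1)) * g)
  rw [X_sub_one_pow_eq, mul_comm (C _), mul_assoc]
  simpa using this

/-- The product (X+1)⋯(X+k) vanishes at -s-j for every j < N, since then 1 ≤ s+j ≤ k; only j = N
survives. -/
lemma eval_hilbertTransform_neg {k N s : ℕ} {q : ℂ[X]} (hq : q.natDegree ≤ N)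
    (hs : 1 ≤ s) (hN : N + s = k + 1) :
    (hilbertTransform k q).eval (-(s : ℂ)) =
      q.coeff N * (risingProd k).eval (-((k : ℂ) + 1)) := by
  rw [eval_hilbertTransform (Nat.lt_succ_of_le hq), Finset.sum_range_succ,
    Finset.sum_eq_zero, zero_add]
  · congr 2
    have : (N : ℂ) + s = k + 1 := by exact_mod_cast hN
    linear_combination -this
  · intro j hj
    rw [Finset.mem_range] at hj
    have := risingProd_eval_neg (k := k) (s := s + j) (by omega) (by omega)
    rw [show -(s : ℂ) - j = -((s + j : ℕ) : ℂ) by push_cast; ring, this, mul_zero]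

lemma eval_hilbertTransform_zero {k : ℕ} {q : ℂ[X]} (hq : q.natDegree ≤ k) :
    (hilbertTransform k q).eval 0 = q.coeff 0 * (risingProd k).eval 0 := by
  rw [eval_hilbertTransform (Nat.lt_succ_of_le hq), Finset.sum_range_succ', Finset.sum_eq_zero]
  · simp
  · intro j hj
    rw [Finset.mem_range] at hj
    rw [zero_sub, risingProd_eval_neg (by omega) (by omega), mul_zero]

/-- The value at -(k + 1 - deg q) is a nonzero multiple of the leading coefficient, so zeros at -1,
…, -d push the degree down. -/
lemma natDegree_le_of_eval_hilbertTransform {k d : ℕ} {q : ℂ[X]} (hq : q.natDegree ≤ k)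
    (h : ∀ s : ℕ, 1 ≤ s → s ≤ d → (hilbertTransform k q).eval (-(s : ℂ)) = 0) :
    q.natDegree ≤ k - d := by
  by_contra! hlt
  have := eval_hilbertTransform_neg (k := k) (s := k + 1 - q.natDegree) (le_refl q.natDegree)
    (by omega) (by omega)
  rw [h _ (by omega) (by omega), eq_comm, mul_eq_zero] at this
  have h0 := this.resolve_right (risingProd_eval_neg_succ_ne_zero k)
  rw [coeff_natDegree, leadingCoeff_eq_zero] at h0
  simp [h0] at hlt

lemma eval_hilbertTransform_neg_eq_zero {k d s : ℕ} {q : ℂ[X]} (hd : d ≤ k)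
    (hq : q.natDegree ≤ k - d) (h1 : 1 ≤ s) (h2 : s ≤ d) :
    (hilbertTransform k q).eval (-(s : ℂ)) = 0 := by
  rw [eval_hilbertTransform_neg (N := k + 1 - s) (by omega) h1 (by omega),
    coeff_eq_zero_of_natDegree_lt (by omega), zero_mul]

lemma eq_zero_of_hilbertTransform_eq_zero {k : ℕ} {q : ℂ[X]} (hq : q.natDegree ≤ k)
    (h : hilbertTransform k q = 0) : q = 0 := by
  have := eval_hilbertTransform_neg (k := k) (s := k + 1 - q.natDegree) (le_refl q.natDegree)
    (by omega) (by omega)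
  rw [h, eval_zero, eq_comm, mul_eq_zero] at this
  simpa using this.resolve_right (risingProd_eval_neg_succ_ne_zero k)

lemma exists_hilbertTransform_eq {k : ℕ} {R : ℂ[X]} (hR : R.natDegree ≤ k) :
    ∃ q : ℂ[X], q.natDegree ≤ k ∧ hilbertTransform k q = R := by
  have hmem : ∀ p : ℂ[X], p ∈ degreeLT ℂ (k + 1) ↔ p.natDegree ≤ k := fun p => by
    rw [mem_degreeLT, degree_lt_iff_coeff_zero, natDegree_le_iff_coeff_eq_zero]
    rfl
  have hmaps : ∀ p ∈ degreeLT ℂ (k + 1), hilbertTransform k p ∈ degreeLT ℂ (k + 1) :=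
    fun p _ => (hmem _).2 (natDegree_hilbertTransform_le k p)
  have : FiniteDimensional ℂ (degreeLT ℂ (k + 1)) :=
    (degreeLTEquiv ℂ (k + 1)).symm.finiteDimensional
  have hinj : Function.Injective ((hilbertTransform k).restrict hmaps) := by
    rw [← LinearMap.ker_eq_bot, LinearMap.ker_eq_bot']
    intro q hq
    refine Subtype.ext (eq_zero_of_hilbertTransform_eq_zero ((hmem _).1 q.2) ?_)
    exact congrArg Subtype.val hq
  obtain ⟨q, hq⟩ := LinearMap.injective_iff_surjective.1 hinj ⟨R, (hmem R).2 hR⟩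
  exact ⟨q, (hmem _).1 q.2, congrArg Subtype.val hq⟩

/-- The remainder modulo (X-1)^(k+1) has degree at most k, where the transform is injective. -/
lemma dvd_of_hilbertTransform_eq_zero {k : ℕ} {p : ℂ[X]} (h : hilbertTransform k p = 0) :
    (X - 1) ^ (k + 1) ∣ p := by
  have hm : ((X - 1 : ℂ[X]) ^ (k + 1)).Monic := (monic_X_sub_C 1).pow _
  rw [← modByMonic_eq_zero_iff_dvd hm]
  have hn : ((X - 1 : ℂ[X]) ^ (k + 1)).natDegree = k + 1 := by
    rw [natDegree_pow, ← C_1, natDegree_X_sub_C, mul_one]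
  have hlt := natDegree_modByMonic_lt p hm (by
    intro h1
    rw [h1, natDegree_one] at hn
    omega)
  refine eq_zero_of_hilbertTransform_eq_zero (k := k) (by omega) ?_
  have := modByMonic_add_div p ((X - 1 : ℂ[X]) ^ (k + 1))
  rw [← this, map_add, hilbertTransform_eq_zero_of_dvd (Dvd.intro _ rfl), add_zero] at h
  exact h

lemma degree_hilbertTransform_lt_of_eval_one_eq_zero {k : ℕ} {p : ℂ[X]} (h : p.eval 1 = 0) :
    (hilbertTransform k p).degree < k := by
  obtain ⟨g, rfl⟩ := dvd_iff_isRoot.2 h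
  have := degree_hilbertTransform_one_sub_X_pow_mul (k := k) (j := 1) (by omega) (-g)
  rwa [show (X - C 1) * g = (1 - X) ^ 1 * -g by rw [C_1]; ring]

/-! ### The basis adapted to both flags -/

section Flag

variable {r k : ℕ} {a d : ℕ → ℕ}

/-- The polynomial with the simple roots `a_i - 1, …, a_i - d_i` for `i = 0, …, r`. -/
def gapPoly (r : ℕ) (a d : ℕ → ℕ) : ℂ[X] :=
  ∏ x ∈ (Finset.range (r + 1)).sigma fun i => Finset.range (d i),
    (X - C ((((a x.1 : ℤ) - x.2 - 1 : ℤ)) : ℂ))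

/-- The block of roots attached to j lies strictly between a_i and a_j for every i < j. So the
blocks are disjoint, and neither a_i nor a_i - d_i - 1 is a root. -/
lemma add_lt_of_gap (hgap : ∀ i < r, a i + d (i + 1) < a (i + 1)) {i j : ℕ} (hij : i < j)
    (hj : j ≤ r) : a i + d j < a j := by
  induction j with
  | zero => omega
  | succ j ih =>
    have h1 := hgap j (by omega)
    rcases Nat.lt_succ_iff_lt_or_eq.1 hij with h | rfl
    · have := ih h (by omega)
      omega
    · exact h1

lemma natDegree_gapPoly (hsum : ∑ i ∈ Finset.range (r + 1), d i = k) :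
    (gapPoly r a d).natDegree = k := by
  rw [gapPoly, natDegree_prod_of_monic _ _ fun x _ => monic_X_sub_C _]
  simp only [natDegree_X_sub_C]
  simpa [Finset.card_sigma] using hsum

lemma eval_gapPoly_eq_zero {i s : ℕ} (hi : i ≤ r) (h1 : 1 ≤ s) (h2 : s ≤ d i) :
    (gapPoly r a d).eval ((a i : ℂ) - s) = 0 := by
  rw [gapPoly, eval_prod]
  refine Finset.prod_eq_zero (i := ⟨i, s - 1⟩) (by simp; omega) ?_
  simp [Nat.cast_sub h1]
  ring

lemma eval_gapPoly_ne_zero {t : ℤ} (h : ∀ i ≤ r, ∀ s < d i, t ≠ (a i : ℤ) - s - 1) :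
    (gapPoly r a d).eval (t : ℂ) ≠ 0 := by
  rw [gapPoly, eval_prod, Finset.prod_ne_zero_iff]
  rintro ⟨i, s⟩ hx
  simp only [Finset.mem_sigma, Finset.mem_range] at hx
  rw [eval_sub, eval_X, eval_C, sub_ne_zero]
  exact_mod_cast h i (by omega) s hx.2

lemma gapPoly_dvd (hgap : ∀ i < r, a i + d (i + 1) < a (i + 1)) {R : ℂ[X]}
    (h : ∀ i ≤ r, ∀ s : ℕ, 1 ≤ s → s ≤ d i → R.eval ((a i : ℂ) - s) = 0) :
    gapPoly r a d ∣ R := by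
  refine Finset.prod_dvd_of_coprime ?_ ?_
  · rintro ⟨i, s⟩ hx ⟨j, t⟩ hy hne
    simp only [Finset.coe_sigma, Set.mem_sigma_iff, Finset.coe_range, Set.mem_Iio] at hx hy
    refine isCoprime_X_sub_C_of_isUnit_sub (sub_ne_zero.2 fun heq => ?_).isUnit
    have heq' : (a i : ℤ) - s - 1 = (a j : ℤ) - t - 1 := by exact_mod_cast heq
    rcases lt_trichotomy i j with hij | rfl | hij
    · have := add_lt_of_gap hgap hij (by omega)
      omega
    · exact hne (by rw [show s = t by omega])
    · have := add_lt_of_gap hgap hij (by omega)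
      omega
  · rintro ⟨i, s⟩ hx
    simp only [Finset.mem_sigma, Finset.mem_range] at hx
    rw [dvd_iff_isRoot, IsRoot]
    rw [show (((a i : ℤ) - s - 1 : ℤ) : ℂ) = (a i : ℂ) - (s + 1 : ℕ) by push_cast; ring]
    exact h i (by omega) (s + 1) (by omega) (by omega)

/-- Undoing the shift by a_i forces the transform of q to be the translate of `gapPoly`; everything
about q is then read from values of `gapPoly`. -/
lemma exists_flag_poly (hgap : ∀ i < r, a i + d (i + 1) < a (i + 1))
    (hsum : ∑ i ∈ Finset.range (r + 1), d i = k) {i : ℕ} (hi : i ≤ r) :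
    ∃ q : ℂ[X], q.natDegree = k - d i ∧ q.coeff 0 ≠ 0 ∧ (X ^ a i * q).eval 1 ≠ 0 ∧
      hilbertTransform k (X ^ a i * q) = gapPoly r a d := by
  have hdk : d i ≤ k := hsum ▸ Finset.single_le_sum (f := d) (fun _ _ => Nat.zero_le _)
    (Finset.mem_range.2 (by omega))
  have hP := natDegree_gapPoly (a := a) hsum
  obtain ⟨q, hqk, hq⟩ := exists_hilbertTransform_eq (k := k)
    (R := taylor (a i : ℂ) (gapPoly r a d)) (by rw [natDegree_taylor, hP])
  have hev : ∀ t : ℂ, (hilbertTransform k q).eval t = (gapPoly r a d).eval (t + a i) := by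
    intro t
    rw [hq, taylor_eval]
  have hH : hilbertTransform k (X ^ a i * q) = gapPoly r a d := by
    refine Polynomial.funext fun t => ?_
    rw [eval_hilbertTransform_X_pow_mul, hev, sub_add_cancel]
  have hle : q.natDegree ≤ k - d i := by
    refine natDegree_le_of_eval_hilbertTransform hqk fun s h1 h2 => ?_
    rw [hev, neg_add_eq_sub, eval_gapPoly_eq_zero hi h1 h2]
  refine ⟨q, le_antisymm hle (le_natDegree_of_ne_zero ?_), ?_, ?_, hH⟩
  -- The coefficient of q in degree k - d_i is seen at a_i - d_i - 1, just below the block of roots.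
  · refine left_ne_zero_of_mul (b := (risingProd k).eval (-((k : ℂ) + 1))) ?_
    rw [← eval_hilbertTransform_neg (s := d i + 1) hle (by omega) (by omega), hev,
      show -((d i + 1 : ℕ) : ℂ) + a i = (((a i : ℤ) - d i - 1 : ℤ) : ℂ) by push_cast; ring]
    refine eval_gapPoly_ne_zero fun j hj s hs => ?_
    rcases lt_trichotomy i j with hij | rfl | hij
    · have := add_lt_of_gap hgap hij hj
      omega
    · omega
    · have := add_lt_of_gap hgap hij hi
      omega
  -- The constant coefficient of q is seen at a_i, just above the block.
  · refine left_ne_zero_of_mul (b := (risingProd k).eval 0) ?_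
    rw [← eval_hilbertTransform_zero hqk, hev, zero_add]
    refine eval_gapPoly_ne_zero (t := a i) fun j hj s hs => ?_
    rcases lt_trichotomy i j with hij | rfl | hij
    · have := add_lt_of_gap hgap hij hj
      omega
    · omega
    · have := add_lt_of_gap hgap hij hi
      omega
  -- A zero at 1 would make the degree of the transform less than k, the degree of `gapPoly`.
  · intro h1
    have := degree_hilbertTransform_lt_of_eval_one_eq_zero (k := k) h1
    rw [hH] at this
    have h0 : gapPoly r a d ≠ 0 := by
      rw [gapPoly]
      exact Finset.prod_ne_zero_iff.2 fun x _ => X_sub_C_ne_zero _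
    rw [degree_eq_natDegree h0, hP] at this
    exact lt_irrefl _ this

/-- The products may exceed degree k, where the transform is not injective; X^b acts as an
invertible shift, so injectivity is needed only for p and q. -/
lemma eq_smul_of_hilbertTransform_eq {b : ℕ} {p q : ℂ[X]} {c : ℂ} (hp : p.natDegree ≤ k)
    (hq : q.natDegree ≤ k)
    (h : hilbertTransform k (X ^ b * p) = c • hilbertTransform k (X ^ b * q)) :
    X ^ b * p = c • (X ^ b * q) := by
  have h0 : p - c • q = 0 := by
    refine eq_zero_of_hilbertTransform_eq_zero (k := k)
      ((natDegree_sub_le _ _).trans (max_le hp ((natDegree_smul_le _ _).trans hq))) ?_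
    refine Polynomial.funext fun t => ?_
    have := congrArg (eval (t + b)) h
    rw [eval_smul, eval_hilbertTransform_X_pow_mul, eval_hilbertTransform_X_pow_mul,
      add_sub_cancel_right] at this
    simp [this]
  rw [sub_eq_zero.1 h0, mul_smul_comm]

/-- All k roots of `gapPoly` are forced on R, whose degree is at most k. -/
lemma exists_smul_gapPoly (hgap : ∀ i < r, a i + d (i + 1) < a (i + 1))
    (hsum : ∑ i ∈ Finset.range (r + 1), d i = k) {q : ℕ → ℂ[X]} {R : ℂ[X]}
    (hq : ∀ i ≤ r, (q i).natDegree ≤ k - d i)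
    (hR : ∀ i ≤ r, hilbertTransform k (X ^ a i * q i) = R) :
    ∃ c : ℂ, R = c • gapPoly r a d := by
  have hP := natDegree_gapPoly (a := a) hsum
  have hRk : R.natDegree ≤ k := hR 0 (Nat.zero_le _) ▸ natDegree_hilbertTransform_le k _
  obtain ⟨g, rfl⟩ := gapPoly_dvd (R := R) hgap fun i hi s h1 h2 => by
    have hdk : d i ≤ k := hsum ▸ Finset.single_le_sum (f := d) (fun _ _ => Nat.zero_le _)
      (Finset.mem_range.2 (by omega))
    rw [← hR i hi, eval_hilbertTransform_X_pow_mul, sub_sub_cancel_left]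
    exact eval_hilbertTransform_neg_eq_zero hdk (hq i hi) h1 h2
  by_cases hg : g = 0
  · exact ⟨0, by simp [hg]⟩
  · have h0 : gapPoly r a d ≠ 0 := by
      rw [gapPoly]
      exact Finset.prod_ne_zero_iff.2 fun x _ => X_sub_C_ne_zero _
    rw [natDegree_mul h0 hg, hP] at hRk
    obtain ⟨c, rfl⟩ := natDegree_eq_zero.1 (show g.natDegree = 0 by omega)
    exact ⟨c, by rw [smul_eq_C_mul, mul_comm]⟩

end Flag

/-! ### Parameters -/

section Parameters

variable {r : ℕ} (m l : Fin r → ℕ) (k : ℕ)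

/-- The exponents `a_i = i + m_1 + … + m_i` at `0`. -/
def expZero (i : ℕ) : ℕ := i + psum m i

/-- The differences `l_i - l_{i+1}`. -/
def gapL (i : ℕ) : ℕ := extL l k i - extL l k (i + 1)

/-- The exponents `e_i` at infinity. -/
def expInfty (i : ℕ) : ℕ := expZero m i + (k - gapL l k i)

/-- The exponents `0, k + 1, k + 2, …` at `1`. -/
def expOne (i : ℕ) : ℕ := i + if i = 0 then 0 else k

variable {m l k}

lemma extL_succ_le (hc : Consistent m l k) (i : ℕ) : extL l k (i + 1) ≤ extL l k i := by
  by_cases hi : i < r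
  · exact hc.1 ⟨i, hi⟩
  · simp [extL, hi]

lemma extL_le (hc : Consistent m l k) (i : ℕ) : extL l k i ≤ k :=
  (antitone_nat_of_succ_le (extL_succ_le hc)) (Nat.zero_le i)

lemma gapL_le (hc : Consistent m l k) (i : ℕ) : gapL l k i ≤ k :=
  (Nat.sub_le _ _).trans (extL_le hc i)

lemma isDegreeExponent_iff (hc : Consistent m l k) {i n : ℕ} :
    IsDegreeExponent m l k i n ↔ n = expInfty m l k i := by
  have h1 := extL_succ_le hc i
  have h2 := extL_le hc i
  simp only [IsDegreeExponent, expInfty, expZero, gapL]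
  omega

lemma psum_succ {i : ℕ} (hi : i < r) : psum m (i + 1) = psum m i + m ⟨i, hi⟩ := by
  have : m ⟨i, hi⟩ = ∑ s : Fin r, if s = ⟨i, hi⟩ then m s else 0 := by simp
  rw [psum, psum, this, ← Finset.sum_add_distrib]
  refine Finset.sum_congr rfl fun s _ => ?_
  rcases lt_trichotomy (s : ℕ) i with h | h | h
  · simp [h, h.trans (Nat.lt_succ_self i), Fin.ext_iff, h.ne]
  · simp [h, Fin.ext_iff]
  · simp [h.not_gt, Fin.ext_iff, h.ne', show ¬ (s : ℕ) < i + 1 by omega]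

/-- This is the condition l_s - l_{s+1} ≤ m_s, since consecutive exponents at 0 differ by m_s + 1.
-/
lemma expZero_add_gapL_lt (hc : Consistent m l k) (i : ℕ) (hi : i < r) :
    expZero m i + gapL l k (i + 1) < expZero m (i + 1) := by
  have h : extL l k (i + 1) ≤ m ⟨i, hi⟩ + extL l k (i + 2) := hc.2 ⟨i, hi⟩
  have h2 : gapL l k (i + 1) = extL l k (i + 1) - extL l k (i + 2) := rfl
  rw [expZero, expZero, psum_succ hi]
  omega

lemma sum_gapL (hc : Consistent m l k) : ∑ i ∈ Finset.range (r + 1), gapL l k i = k := by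
  have h : ∀ n, ∑ i ∈ Finset.range n, gapL l k i + extL l k n = k := by
    intro n
    induction n with
    | zero => simp [extL]
    | succ n ih =>
      have h1 := extL_succ_le hc n
      rw [Finset.sum_range_succ, gapL]
      omega
  have hr := h (r + 1)
  simpa [extL] using hr

lemma expZero_lt (hc : Consistent m l k) {i j : ℕ} (hij : i < j) (hj : j ≤ r) :
    expZero m i < expZero m j :=
  (Nat.le_add_right _ _).trans_lt (add_lt_of_gap (expZero_add_gapL_lt hc) hij hj)

lemma expInfty_lt (hc : Consistent m l k) {i j : ℕ} (hij : i < j) (hj : j ≤ r) :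
    expInfty m l k i < expInfty m l k j := by
  have := add_lt_of_gap (expZero_add_gapL_lt hc) hij hj
  have := gapL_le hc j
  rw [expInfty, expInfty]
  omega

/-- Each e_i - a_i is k - d_i, and the d_i add up to k. -/
lemma sum_expInfty (hc : Consistent m l k) :
    ∑ i : Fin (r + 1), expInfty m l k i = ∑ i : Fin (r + 1), expZero m i + r * k := by
  have h1 : ∑ i : Fin (r + 1), expInfty m l k i + ∑ i : Fin (r + 1), gapL l k i =
      ∑ i : Fin (r + 1), expZero m i + (r + 1) * k := by
    rw [← Finset.sum_add_distrib]
    have : ∀ i : Fin (r + 1), expInfty m l k i + gapL l k i = expZero m i + k := fun i => by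
      have := gapL_le hc i
      rw [expInfty]
      omega
    simp [this, Finset.sum_add_distrib]
  have h2 := sum_gapL hc
  rw [← Fin.sum_univ_eq_sum_range] at h2
  rw [h2] at h1
  linarith

lemma sum_expOne (k n : ℕ) :
    ∑ i : Fin (n + 1), expOne k i = ∑ i : Fin (n + 1), (i : ℕ) + n * k := by
  simp only [expOne, Finset.sum_add_distrib]
  congr 1
  rw [Fin.sum_univ_succ]
  simp

lemma exponentSet_eq_range (n : Fin r → ℕ) :
    exponentSet n = Set.range fun i : Fin (r + 1) => expZero n i := rfl

lemma exponentSet_zero :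
    exponentSet (fun _ : Fin r => 0) = Set.range fun i : Fin (r + 1) => (i : ℕ) := by
  simp [exponentSet, psum]

lemma exponentSet_one (hr : 0 < r) :
    exponentSet (fun s : Fin r => if (s : ℕ) = 0 then k else 0) =
      Set.range fun i : Fin (r + 1) => expOne k i := by
  have h : ∀ i : Fin (r + 1), psum (fun s : Fin r => if (s : ℕ) = 0 then k else 0) i =
      if (i : ℕ) = 0 then 0 else k := by
    intro i
    rw [psum, Finset.sum_eq_single ⟨0, hr⟩]
    · rcases Nat.eq_zero_or_pos (i : ℕ) with h | h
      · simp [h]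
      · simp [h, h.ne']
    · intro s _ hs
      have : (s : ℕ) ≠ 0 := fun h => hs (Fin.ext h)
      simp [this]
    · simp
  simp only [exponentSet, expOne, h]

lemma expOne_le_of_strictMono {n : ℕ} {d : Fin n → ℕ} (hd : StrictMono d)
    (h : ∀ j, d j = 0 ∨ k + 1 ≤ d j) (j : Fin n) : expOne k j ≤ d j := by
  obtain ⟨j, hj⟩ := j
  induction j with
  | zero => simp [expOne]
  | succ j ih =>
    have h1 := ih (by omega)
    have h2 : d ⟨j, by omega⟩ < d ⟨j + 1, hj⟩ := hd (by simp [Fin.lt_def])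
    have h3 := h ⟨j + 1, hj⟩
    simp only [expOne] at h1 ⊢
    split_ifs at h1 ⊢ <;> omega

lemma le_of_strictMono_fin {n : ℕ} {d : Fin n → ℕ} (hd : StrictMono d) (j : Fin n) :
    (j : ℕ) ≤ d j := by
  simpa [expOne] using expOne_le_of_strictMono (k := 0) hd (fun j => by omega) j

lemma eq_of_le_of_sum_le {n : ℕ} {b d : Fin n → ℕ} (hle : ∀ j, b j ≤ d j)
    (hsum : ∑ j, d j ≤ ∑ j, b j) : d = b := by
  have h := (Finset.sum_eq_sum_iff_of_le fun j _ => hle j).1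
    (le_antisymm (Finset.sum_le_sum fun j _ => hle j) hsum)
  exact funext fun j => (h j (Finset.mem_univ j)).symm

/-- Each m_s occurs in the partial sums that contain it, which gives its exponent in the product of
powers of the T_i. -/
lemma sum_psum {p : ℕ} :
    ∑ j : Fin (p + 1), psum m j =
      ∑ s : Fin r, if (s : ℕ) < p then m s * (p - (s : ℕ)) else 0 := by
  simp only [psum]
  rw [Finset.sum_comm]
  refine Finset.sum_congr rfl fun s _ => ?_
  rw [Fin.sum_univ_eq_sum_range (fun j => if (s : ℕ) < j then m s else 0)]
  clear * -
  induction p with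
  | zero => simp
  | succ p ih =>
    rw [Finset.sum_range_succ, ih]
    rcases lt_trichotomy (s : ℕ) p with h | h | h
    · rw [if_pos h, if_pos (by omega), if_pos (by omega), Nat.succ_sub h.le, Nat.mul_succ]
    · simp [h]
    · simp [show ¬ (s : ℕ) < p by omega, show ¬ (s : ℕ) < p + 1 by omega]

lemma prod_polyT (hr : 0 < r) (p : ℕ) :
    (∏ j : Fin r, if (j : ℕ) < p then polyT m k j ^ (p - (j : ℕ)) else 1) =
      X ^ (∑ j : Fin (p + 1), psum m j) * (X - 1) ^ (p * k) := by
  have h : ∀ j : Fin r, (if (j : ℕ) < p then polyT m k j ^ (p - (j : ℕ)) else 1) =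
      X ^ (if (j : ℕ) < p then m j * (p - (j : ℕ)) else 0) *
        (if j = ⟨0, hr⟩ then (X - 1) ^ (p * k) else 1) := by
    intro j
    by_cases hj : (j : ℕ) = 0
    · have hj' : j = ⟨0, hr⟩ := Fin.ext hj
      rcases Nat.eq_zero_or_pos p with rfl | hp
      · simp
      · subst hj'
        simp [polyT, hp, mul_pow, ← pow_mul, mul_comm]
    · have hj' : j ≠ ⟨0, hr⟩ := fun h => hj (congrArg Fin.val h)
      split_ifs <;> simp [polyT, hj, ← pow_mul]
  rw [Finset.prod_congr rfl fun j _ => h j, Finset.prod_mul_distrib, Finset.prod_pow_eq_pow_sum,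
    Finset.prod_ite_eq', if_pos (Finset.mem_univ _), sum_psum]

end Parameters

/-! ### The space with the prescribed exponents -/

lemma exists_dvd_sub_smul {n : ℕ} {h : Fin n → ℂ[X]} {u M : ℂ[X]} (hM : ∀ i, M ∣ h i - u)
    {f : ℂ[X]} (hf : f ∈ Submodule.span ℂ (Set.range h)) : ∃ c : ℂ, M ∣ f - c • u := by
  obtain ⟨c, rfl⟩ := (Submodule.mem_span_range_iff_exists_fun ℂ).1 hf
  refine ⟨∑ i, c i, ?_⟩
  rw [Finset.sum_smul, ← Finset.sum_sub_distrib]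
  refine Finset.dvd_sum fun i _ => ?_
  rw [← smul_sub, smul_eq_C_mul]
  exact (hM i).mul_left _

/-- Every element is congruent to a multiple of u; vanishing at 1 forces that multiple to be zero.
-/
lemma rootMultiplicity_one_of_mem_span {n k : ℕ} {h : Fin n → ℂ[X]} {u : ℂ[X]}
    (hu : u.eval 1 ≠ 0) (hM : ∀ i, (X - 1) ^ (k + 1) ∣ h i - u) {f : ℂ[X]} (hf0 : f ≠ 0)
    (hf : f ∈ Submodule.span ℂ (Set.range h)) :
    f.rootMultiplicity 1 = 0 ∨ k + 1 ≤ f.rootMultiplicity 1 := by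
  obtain ⟨c, hc⟩ := exists_dvd_sub_smul hM hf
  by_cases h1 : f.eval 1 = 0
  · right
    have h2 : (f - c • u).eval 1 = 0 := by
      obtain ⟨g, hg⟩ := hc
      simp [hg]
    have hc0 : c = 0 := by
      rw [eval_sub, h1, eval_smul, zero_sub, neg_eq_zero, smul_eq_mul] at h2
      exact (mul_eq_zero.1 h2).resolve_right hu
    rw [hc0, zero_smul, sub_zero] at hc
    exact (le_rootMultiplicity_iff hf0).2 (by simpa using hc)
  · exact Or.inl (rootMultiplicity_eq_zero h1)

lemma sum_rootMultiplicity_le_natDegree {w : ℂ[X]} (hw : w ≠ 0) (s : Finset ℂ) :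
    ∑ z ∈ s, w.rootMultiplicity z ≤ w.natDegree := by
  classical
  calc ∑ z ∈ s, w.rootMultiplicity z ≤ ∑ z ∈ s ∪ w.roots.toFinset, w.roots.count z := by
        simp only [count_roots]
        exact Finset.sum_le_sum_of_subset Finset.subset_union_left
    _ = w.roots.card := Multiset.sum_count_eq_card fun z hz => by simp_all
    _ ≤ w.natDegree := card_roots' w

section Space

variable {r k : ℕ} {m l : Fin r → ℕ} {h : Fin (r + 1) → ℂ[X]}

/-- Polynomials `h_0, …, h_r` of orders `a_i` at `0` and degrees `e_i` that are nonzero at `1` and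
have the same image `gapPoly` under the transform `hilbertTransform k`. -/
structure IsFlagBasis (m l : Fin r → ℕ) (k : ℕ) (h : Fin (r + 1) → ℂ[X]) : Prop where
  natDegree_eq : ∀ i, (h i).natDegree = expInfty m l k i
  rootMultiplicity_zero : ∀ i, (h i).rootMultiplicity 0 = expZero m i
  eval_one_ne_zero : ∀ i, (h i).eval 1 ≠ 0
  hilbertTransform_eq : ∀ i, hilbertTransform k (h i) = gapPoly r (expZero m) (gapL l k)
  eq_smul : ∀ i : Fin (r + 1), ∀ q : ℂ[X], ∀ c : ℂ, q.natDegree ≤ k →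
    hilbertTransform k (X ^ expZero m i * q) = c • gapPoly r (expZero m) (gapL l k) →
    X ^ expZero m i * q = c • h i

lemma exists_isFlagBasis (hc : Consistent m l k) : ∃ h, IsFlagBasis m l k h := by
  have hex : ∀ i : Fin (r + 1), _ := fun i =>
    exists_flag_poly (expZero_add_gapL_lt hc) (sum_gapL hc) (Nat.lt_succ_iff.1 i.2)
  choose q hdeg h0 h1 hH using hex
  have hq0 : ∀ i, q i ≠ 0 := fun i h => h0 i (by simp [h])
  refine ⟨fun i => X ^ expZero m i * q i, ⟨fun i => ?_, fun i => ?_, h1, hH, fun i p c hp h => ?_⟩⟩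
  · rw [natDegree_X_pow_mul _ (hq0 i), hdeg, add_comm, expInfty]
  · rw [rootMultiplicity_eq_natTrailingDegree',
      natTrailingDegree_mul (pow_ne_zero _ X_ne_zero) (hq0 i), natTrailingDegree_X_pow,
      natTrailingDegree_eq_zero.2 (Or.inr (h0 i)), add_zero]
  · exact eq_smul_of_hilbertTransform_eq hp (by rw [hdeg]; exact Nat.sub_le _ _)
      (by rw [h, hH])

namespace IsFlagBasis

lemma ne_zero (H : IsFlagBasis m l k h) (i : Fin (r + 1)) : h i ≠ 0 := fun h0 =>
  H.eval_one_ne_zero i (by simp [h0])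

lemma dvd_sub (H : IsFlagBasis m l k h) (i j : Fin (r + 1)) :
    (X - 1) ^ (k + 1) ∣ h i - h j :=
  dvd_of_hilbertTransform_eq_zero (by
    rw [map_sub, H.hilbertTransform_eq, H.hilbertTransform_eq, sub_self])

lemma injective_natDegree (H : IsFlagBasis m l k h) (hc : Consistent m l k) :
    Function.Injective fun i => (h i).natDegree := by
  simp only [H.natDegree_eq]
  refine StrictMono.injective (f := fun i : Fin (r + 1) => expInfty m l k i) fun i j hij => ?_
  exact expInfty_lt hc hij (Nat.lt_succ_iff.1 j.2)

lemma injective_rootMultiplicity (H : IsFlagBasis m l k h) (hc : Consistent m l k) :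
    Function.Injective fun i => (h i).rootMultiplicity 0 := by
  simp only [H.rootMultiplicity_zero]
  refine StrictMono.injective (f := fun i : Fin (r + 1) => expZero m i) fun i j hij => ?_
  exact expZero_lt hc hij (Nat.lt_succ_iff.1 j.2)

lemma linearIndependent (H : IsFlagBasis m l k h) (hc : Consistent m l k) :
    LinearIndependent ℂ h :=
  linearIndependent_of_polyWronskian_ne_zero
    (polyWronskian_of_natDegree h H.ne_zero (H.injective_natDegree hc)).1

/-- Every initial segment of the basis has exponents at least `0, k + 1, k + 2, …` at `1`. -/
lemma exists_exponents_one (H : IsFlagBasis m l k h) (hc : Consistent m l k) {n : ℕ}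
    {ι : Fin n → Fin (r + 1)} (hι : Function.Injective ι) :
    ∃ d : Fin n → ℕ, (∀ j : Fin n, expOne k j ≤ d j) ∧
      exponentsAt (Submodule.span ℂ (Set.range (h ∘ ι))) 1 = Set.range d ∧
      polyWronskian (h ∘ ι) ≠ 0 ∧
      (polyWronskian (h ∘ ι)).rootMultiplicity 1 + ∑ i : Fin n, (i : ℕ) = ∑ j, d j := by
  obtain ⟨d, hd, hr, hw⟩ := exists_exponents ((H.linearIndependent hc).comp ι hι) 1
  refine ⟨d, expOne_le_of_strictMono hd fun j => ?_, hr, hw⟩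
  obtain ⟨f, hf, hf0, hfd⟩ := hr.symm.subset (Set.mem_range_self j)
  rw [← hfd]
  exact rootMultiplicity_one_of_mem_span (H.eval_one_ne_zero 0) (fun i => H.dvd_sub _ 0) hf0 hf

lemma natDegree_polyWronskian (H : IsFlagBasis m l k h) (hc : Consistent m l k) :
    (polyWronskian h).natDegree = (polyWronskian h).rootMultiplicity 0 + r * k := by
  have h1 := (polyWronskian_of_natDegree h H.ne_zero (H.injective_natDegree hc)).2
  have h2 := (polyWronskian_of_rootMultiplicity_zero h H.ne_zero
    (H.injective_rootMultiplicity hc)).2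
  simp only [H.natDegree_eq, sum_expInfty hc] at h1
  simp only [H.rootMultiplicity_zero] at h2
  omega

lemma exponentsAt_zero (H : IsFlagBasis m l k h) (hc : Consistent m l k) :
    exponentsAt (Submodule.span ℂ (Set.range h)) 0 =
      Set.range fun i : Fin (r + 1) => expZero m i := by
  have : FiniteDimensional ℂ (Submodule.span ℂ (Set.range h)) :=
    FiniteDimensional.span_of_finite ℂ (Set.finite_range h)
  have hfin := finite_exponentsAt (Submodule.span ℂ (Set.range h)) 0
  have hcard : hfin.toFinset.card = r + 1 := by
    rw [card_exponentsAt, finrank_span_eq_card (H.linearIndependent hc), Fintype.card_fin]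
  have hsub : Finset.univ.image (fun i : Fin (r + 1) => expZero m i) ⊆ hfin.toFinset := by
    intro d hd
    obtain ⟨i, -, rfl⟩ := Finset.mem_image.1 hd
    rw [Set.Finite.mem_toFinset]
    exact ⟨h i, Submodule.subset_span ⟨i, rfl⟩, H.ne_zero i, H.rootMultiplicity_zero i⟩
  have hinj := H.injective_rootMultiplicity hc
  simp only [H.rootMultiplicity_zero] at hinj
  have := Finset.eq_of_subset_of_card_le hsub (by
    rw [hcard, Finset.card_image_of_injective _ hinj, Finset.card_univ, Fintype.card_fin])
  rw [← hfin.coe_toFinset, ← this]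
  simp

/-- The degree of the Wronskian leaves room for r * k zeros away from 0, and the lower bounds at 1
already use all of them. The same budget leaves no zeros elsewhere. -/
lemma exponentsAt_one (H : IsFlagBasis m l k h) (hc : Consistent m l k) :
    exponentsAt (Submodule.span ℂ (Set.range h)) 1 =
      Set.range fun i : Fin (r + 1) => expOne k i := by
  obtain ⟨d, hd, hr, hw, hs⟩ := H.exists_exponents_one hc (ι := id) Function.injective_id
  rw [Function.comp_id] at hr hw hs
  rw [hr]
  congr 1
  refine eq_of_le_of_sum_le hd ?_
  have h1 := sum_rootMultiplicity_le_natDegree hw {0, 1}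
  rw [Finset.sum_pair zero_ne_one, H.natDegree_polyWronskian hc] at h1
  rw [sum_expOne]
  omega

lemma exponentsAt_of_ne (H : IsFlagBasis m l k h) (hc : Consistent m l k) {z : ℂ}
    (h0 : z ≠ 0) (h1 : z ≠ 1) :
    exponentsAt (Submodule.span ℂ (Set.range h)) z =
      Set.range fun i : Fin (r + 1) => (i : ℕ) := by
  obtain ⟨d, hd, -, -, hs⟩ := H.exists_exponents_one hc (ι := id) Function.injective_id
  obtain ⟨d', hd', hr, hw, hs'⟩ := exists_exponents (H.linearIndependent hc) z
  rw [Function.comp_id] at hs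
  rw [hr]
  congr 1
  refine eq_of_le_of_sum_le (le_of_strictMono_fin hd') ?_
  have h2 := sum_rootMultiplicity_le_natDegree hw {0, 1, z}
  rw [Finset.sum_insert (by simp [h0.symm]), Finset.sum_pair h1.symm,
    H.natDegree_polyWronskian hc] at h2
  have h3 := Finset.sum_le_sum fun (j : Fin (r + 1)) (_ : j ∈ Finset.univ) => hd j
  rw [sum_expOne] at h3
  omega

lemma exponentsAtInfinity_eq (H : IsFlagBasis m l k h) (hc : Consistent m l k) :
    exponentsAtInfinity (Submodule.span ℂ (Set.range h)) =
      Set.range fun i : Fin (r + 1) => expInfty m l k i := by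
  have : FiniteDimensional ℂ (Submodule.span ℂ (Set.range h)) :=
    FiniteDimensional.span_of_finite ℂ (Set.finite_range h)
  have hinj := H.injective_natDegree hc
  simp only [H.natDegree_eq] at hinj
  have hsub : (Set.range fun i : Fin (r + 1) => expInfty m l k i) ⊆
      exponentsAtInfinity (Submodule.span ℂ (Set.range h)) := by
    rintro _ ⟨i, rfl⟩
    exact ⟨h i, Submodule.subset_span ⟨i, rfl⟩, H.ne_zero i, H.natDegree_eq i⟩
  refine Set.Subset.antisymm (fun d hd => ?_) hsub
  by_contra hd'
  have hn : d ∉ Finset.univ.image fun i : Fin (r + 1) => expInfty m l k i := by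
    simpa using hd'
  have := card_le_finrank_of_subset_exponentsAtInfinity
    (V := Submodule.span ℂ (Set.range h))
    (T := insert d (Finset.univ.image fun i : Fin (r + 1) => expInfty m l k i)) (by
      rw [Finset.coe_insert, Finset.coe_image, Finset.coe_univ, Set.image_univ]
      exact Set.insert_subset hd hsub)
  rw [Finset.card_insert_of_notMem hn, Finset.card_image_of_injective _ hinj, Finset.card_univ,
    Fintype.card_fin, finrank_span_eq_card (H.linearIndependent hc), Fintype.card_fin] at this
  omega

end IsFlagBasis

lemma setOf_isDegreeExponent (hc : Consistent m l k) :
    {d | ∃ i ≤ r, IsDegreeExponent m l k i d} =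
      Set.range fun i : Fin (r + 1) => expInfty m l k i := by
  ext d
  simp only [isDegreeExponent_iff hc, Set.mem_ofPred_eq, Set.mem_range]
  exact ⟨fun ⟨i, hi, h⟩ => ⟨⟨i, Nat.lt_succ_of_le hi⟩, h.symm⟩,
    fun ⟨i, h⟩ => ⟨i, Nat.lt_succ_iff.1 i.2, h.symm⟩⟩

lemma IsFlagBasis.isSpaceV (H : IsFlagBasis m l k h) (hr : 0 < r) (hc : Consistent m l k) :
    IsSpaceV m l k (Submodule.span ℂ (Set.range h)) where
  finrank_eq := by
    rw [finrank_span_eq_card (H.linearIndependent hc), Fintype.card_fin]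
  exponents z := by
    rw [localData]
    split_ifs with h0 h1
    · rw [h0, H.exponentsAt_zero hc, exponentSet_eq_range]
    · rw [h1, H.exponentsAt_one hc, exponentSet_one hr]
    · rw [H.exponentsAt_of_ne hc h0 h1, exponentSet_zero]
  exponents_infinity := by
    rw [H.exponentsAtInfinity_eq hc, setOf_isDegreeExponent hc]

/-! ### Uniqueness of the space -/

/-- A space with the prescribed exponents contains a nonzero polynomial of order at least `a_i` at
`0` and of degree at most `e_i`. -/
lemma IsSpaceV.exists_mem {V : Submodule ℂ ℂ[X]} (hV : IsSpaceV m l k V)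
    (hc : Consistent m l k) (i : Fin (r + 1)) :
    ∃ f ∈ V, f ≠ 0 ∧ X ^ expZero m i ∣ f ∧ f.natDegree ≤ expInfty m l k i := by
  have : FiniteDimensional ℂ V :=
    FiniteDimensional.of_finrank_pos (by rw [hV.finrank_eq]; omega)
  have h0 : ∀ j : Fin (r + 1), ∃ f ∈ V, f ≠ 0 ∧ f.rootMultiplicity 0 = expZero m j := fun j => by
    have := hV.exponents 0
    rw [localData, if_pos rfl, exponentSet_eq_range] at this
    exact this.symm.subset (Set.mem_range_self j)
  have hi : ∀ j : Fin (r + 1), ∃ f ∈ V, f ≠ 0 ∧ f.natDegree = expInfty m l k j := fun j => by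
    have := hV.exponents_infinity
    rw [setOf_isDegreeExponent hc] at this
    exact this.symm.subset (Set.mem_range_self j)
  choose F hFV hF0 hF using h0
  choose G hGV hG0 hG using hi
  let A : Submodule ℂ ℂ[X] :=
    V ⊓ (Ideal.span {(X : ℂ[X]) ^ expZero m i}).restrictScalars ℂ
  let B : Submodule ℂ ℂ[X] := V ⊓ degreeLE ℂ (expInfty m l k i)
  have hAV : A ≤ V := inf_le_left
  have hBV : B ≤ V := inf_le_left
  have : FiniteDimensional ℂ A := Submodule.finiteDimensional_of_le hAV
  have : FiniteDimensional ℂ B := Submodule.finiteDimensional_of_le hBV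
  have hA : r + 1 - i ≤ Module.finrank ℂ A := by
    refine card_le_of_linearIndependent_mem (n := r + 1 - i)
      (f := fun j => F ⟨i + j, by omega⟩)
      (linearIndependent_of_polyWronskian_ne_zero
        (polyWronskian_of_rootMultiplicity_zero _ (fun j => hF0 _) ?_).1) fun j => ?_
    · simp only [hF]
      refine StrictMono.injective fun j j' hj => ?_
      exact expZero_lt hc (Nat.add_lt_add_left hj _) (by omega)
    · refine ⟨hFV _, Ideal.mem_span_singleton.2 ?_⟩
      have hle : expZero m i ≤ expZero m (i + j) := by
        rcases Nat.eq_zero_or_pos (j : ℕ) with h | h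
        · simp [h]
        · exact (expZero_lt hc (by omega) (by omega)).le
      have := (le_rootMultiplicity_iff (hF0 ⟨i + j, by omega⟩) (a := 0)
        (n := expZero m i)).1 (by rw [hF]; exact hle)
      simpa using this
  have hB : (i : ℕ) + 1 ≤ Module.finrank ℂ B := by
    refine card_le_of_linearIndependent_mem (n := i + 1)
      (f := fun j => G ⟨j, by omega⟩)
      (linearIndependent_of_polyWronskian_ne_zero
        (polyWronskian_of_natDegree _ (fun j => hG0 _) ?_).1) fun j => ?_
    · simp only [hG]
      refine StrictMono.injective fun j j' hj => ?_
      exact expInfty_lt hc hj (by omega)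
    · refine ⟨hGV _, mem_degreeLE.2 (natDegree_le_iff_degree_le.1 ?_)⟩
      rw [hG]
      rcases Nat.lt_or_eq_of_le (Nat.lt_succ_iff.1 j.2) with h | h
      · exact (expInfty_lt hc h (by omega)).le
      · exact (congrArg (expInfty m l k) h).le
  -- The dimensions are at least r + 1 - i and i + 1, with sum r + 2, so the two subspaces of V meet
  -- nontrivially.
  have hsum := Submodule.finrank_sup_add_finrank_inf_eq A B
  have hsup : Module.finrank ℂ (A ⊔ B : Submodule ℂ ℂ[X]) ≤ r + 1 := by
    rw [← hV.finrank_eq]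
    exact Submodule.finrank_mono (sup_le hAV hBV)
  have hinf : A ⊓ B ≠ ⊥ := by
    intro hbot
    rw [hbot, finrank_bot] at hsum
    omega
  obtain ⟨f, hf, hf0⟩ := Submodule.exists_mem_ne_zero_of_ne_bot hinf
  exact ⟨f, hf.1.1, hf0, Ideal.mem_span_singleton.1 hf.1.2,
    natDegree_le_iff_degree_le.2 (mem_degreeLE.1 hf.2.2)⟩

lemma IsSpaceV.dvd_of_eval_one {V : Submodule ℂ ℂ[X]} (hV : IsSpaceV m l k V) (hr : 0 < r)
    {f : ℂ[X]} (hf : f ∈ V) (h1 : f.eval 1 = 0) : (X - 1) ^ (k + 1) ∣ f := by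
  by_cases hf0 : f = 0
  · simp [hf0]
  have := hV.exponents 1
  rw [localData, if_neg one_ne_zero, if_pos rfl, exponentSet_one hr] at this
  obtain ⟨i, hi⟩ := this.subset ⟨f, hf, hf0, rfl⟩
  have hpos : 0 < f.rootMultiplicity 1 := (rootMultiplicity_pos hf0).2 h1
  have hle : k + 1 ≤ f.rootMultiplicity 1 := by
    rw [← hi] at hpos ⊢
    simp only [expOne] at hpos ⊢
    split_ifs at hpos ⊢ <;> omega
  simpa using (le_rootMultiplicity_iff hf0).1 hle

lemma IsSpaceV.eq_span {V : Submodule ℂ ℂ[X]} (hV : IsSpaceV m l k V) (hr : 0 < r)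
    (hc : Consistent m l k) (H : IsFlagBasis m l k h) : V = Submodule.span ℂ (Set.range h) := by
  have : FiniteDimensional ℂ V :=
    FiniteDimensional.of_finrank_pos (by rw [hV.finrank_eq]; omega)
  choose f hfV hf0 hfX hfd using fun i => hV.exists_mem hc i
  choose q hq using hfX
  have hq0 : ∀ i, q i ≠ 0 := fun i h => hf0 i (by rw [hq, h, mul_zero])
  have hqd : ∀ i : Fin (r + 1), (q i).natDegree ≤ k - gapL l k i := fun i => by
    have := hfd i
    rw [hq, natDegree_X_pow_mul _ (hq0 i), expInfty] at this
    omega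
  -- Otherwise (X-1)^(k+1) would divide the nonzero q_i, whose degree is at most k.
  have hf1 : ∀ i, (f i).eval 1 ≠ 0 := fun i h1 => by
    have hd := hV.dvd_of_eval_one hr (hfV i) h1
    have hcop : IsCoprime ((X - 1 : ℂ[X]) ^ (k + 1)) (X ^ expZero m i) :=
      IsCoprime.pow ⟨-1, 1, by ring⟩
    rw [hq] at hd
    have := natDegree_le_of_dvd (hcop.dvd_of_dvd_mul_left hd) (hq0 i)
    rw [natDegree_pow, ← C_1, natDegree_X_sub_C, mul_one] at this
    have := hqd i
    omega
  -- Scaling to value 1 at 1 makes all differences vanish there, hence lie in the kernel of the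
  -- transform.
  set b : Fin (r + 1) → ℂ := fun i => ((f i).eval 1)⁻¹ with hb
  have hb0 : ∀ i, b i ≠ 0 := fun i => inv_ne_zero (hf1 i)
  have hH : ∀ i, hilbertTransform k (b i • f i) = hilbertTransform k (b 0 • f 0) := fun i => by
    rw [← sub_eq_zero, ← map_sub]
    refine hilbertTransform_eq_zero_of_dvd (hV.dvd_of_eval_one hr
      (V.sub_mem (V.smul_mem _ (hfV i)) (V.smul_mem _ (hfV 0))) ?_)
    simp [hb, hf1]
  have hmul : ∀ i : Fin (r + 1), X ^ expZero m i * (b i • q i) = b i • f i := fun i => by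
    rw [mul_smul_comm, ← hq]
  have hbd : ∀ i : Fin (r + 1), (b i • q i).natDegree ≤ k - gapL l k i := fun i =>
    (natDegree_smul_le _ _).trans (hqd i)
  obtain ⟨c, hcR⟩ := exists_smul_gapPoly (expZero_add_gapL_lt hc) (sum_gapL hc)
    (q := fun i => b (Fin.ofNat (r + 1) i) • q (Fin.ofNat (r + 1) i))
    (R := hilbertTransform k (b 0 • f 0))
    (fun i hi => by
      have := hbd ⟨i, Nat.lt_succ_of_le hi⟩
      rwa [show Fin.ofNat (r + 1) i = ⟨i, Nat.lt_succ_of_le hi⟩ from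
        Fin.ext (Nat.mod_eq_of_lt (Nat.lt_succ_of_le hi))])
    (fun i hi => by
      have := hmul ⟨i, Nat.lt_succ_of_le hi⟩
      rw [show Fin.ofNat (r + 1) i = ⟨i, Nat.lt_succ_of_le hi⟩ from
        Fin.ext (Nat.mod_eq_of_lt (Nat.lt_succ_of_le hi)), this, hH])
  have hbf : ∀ i, b i • f i = c • h i := fun i => by
    rw [← hmul]
    refine H.eq_smul i _ c ((hbd i).trans (Nat.sub_le _ _)) ?_
    rw [hmul, hH, hcR]
  have hc0 : c ≠ 0 := by
    rintro rfl
    have := hbf 0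
    rw [zero_smul, smul_eq_zero] at this
    exact this.elim (hb0 0) (hf0 0)
  symm
  refine Submodule.eq_of_le_of_finrank_eq ?_ ?_
  · rw [Submodule.span_le]
    rintro _ ⟨i, rfl⟩
    have : h i = c⁻¹ • b i • f i := by rw [hbf, inv_smul_smul₀ hc0]
    rw [SetLike.mem_coe, this]
    exact V.smul_mem _ (V.smul_mem _ (hfV i))
  · rw [hV.finrank_eq, finrank_span_eq_card (H.linearIndependent hc), Fintype.card_fin]

/-! ### The divided Wronskians -/

namespace IsFlagBasis

/-- The h_i have distinct degrees, so no cancellation of top terms occurs in a combination. -/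
lemma mem_span_of_natDegree_le (H : IsFlagBasis m l k h) (hc : Consistent m l k) {f : ℂ[X]}
    (hf : f ∈ Submodule.span ℂ (Set.range h)) {p : ℕ} (hp : p ≤ r)
    (hd : f.natDegree ≤ expInfty m l k p) :
    f ∈ Submodule.span ℂ
      (Set.range fun j : Fin (p + 1) => h (Fin.castLE (Nat.add_le_add_right hp 1) j)) := by
  obtain ⟨c, rfl⟩ := (Submodule.mem_span_range_iff_exists_fun ℂ).1 hf
  have hinj := H.injective_natDegree hc
  have hne : ∀ i, c i • h i ≠ 0 → c i ≠ 0 := fun i hi => left_ne_zero_of_smul hi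
  have hdeg : ∀ i, c i ≠ 0 → (c i • h i).degree = (expInfty m l k i : ℕ) := fun i hi => by
    rw [degree_smul_of_smul_regular _ (IsSMulRegular.of_ne_zero hi),
      degree_eq_natDegree (H.ne_zero i), H.natDegree_eq]
  have hsum := degree_sum_eq_of_disjoint (fun i => c i • h i) Finset.univ (by
    rintro i ⟨-, hi⟩ j ⟨-, hj⟩ hij hd'
    simp only [Function.comp_apply] at hd'
    rw [hdeg i (hne i hi), hdeg j (hne j hj)] at hd'
    refine hij (hinj ?_)
    simp only [H.natDegree_eq]
    exact_mod_cast hd')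
  refine Submodule.sum_mem _ fun i _ => ?_
  by_cases hi : c i = 0
  · rw [hi, zero_smul]
    exact Submodule.zero_mem _
  · have hle : (expInfty m l k i : WithBot ℕ) ≤ (expInfty m l k p : ℕ) := by
      refine le_trans ?_ (natDegree_le_iff_degree_le.1 hd)
      rw [hsum, ← hdeg i hi]
      exact Finset.le_sup (f := fun i => (c i • h i).degree) (Finset.mem_univ i)
    have hip : (i : ℕ) < p + 1 := by
      by_contra! hlt
      have := expInfty_lt hc hlt (Nat.lt_succ_iff.1 i.2)
      have hle' : expInfty m l k i ≤ expInfty m l k p := by exact_mod_cast hle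
      omega
    exact Submodule.smul_mem _ _ (Submodule.subset_span ⟨⟨i, hip⟩, rfl⟩)

lemma polyWronskian_segment (H : IsFlagBasis m l k h) (hc : Consistent m l k) {p : ℕ}
    (hp : p ≤ r) :
    ∃ g : ℂ[X], g.eval 0 ≠ 0 ∧
      polyWronskian (fun j : Fin (p + 1) => h (Fin.castLE (Nat.add_le_add_right hp 1) j)) =
        X ^ (∑ j : Fin (p + 1), psum m j) * (X - 1) ^ (p * k) * g := by
  have hι := Fin.castLE_injective (Nat.add_le_add_right hp 1)
  obtain ⟨d, hd, -, hw, hs⟩ := H.exists_exponents_one hc hι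
  have h0 := (polyWronskian_of_rootMultiplicity_zero (h ∘ Fin.castLE (Nat.add_le_add_right hp 1))
    (fun j => H.ne_zero _) ((H.injective_rootMultiplicity hc).comp hι)).2
  simp only [Function.comp_apply, H.rootMultiplicity_zero, Fin.val_castLE, expZero,
    Finset.sum_add_distrib] at h0
  change ∃ g : ℂ[X], g.eval 0 ≠ 0 ∧ polyWronskian (h ∘ Fin.castLE (Nat.add_le_add_right hp 1)) = _
  set w := polyWronskian (h ∘ Fin.castLE (Nat.add_le_add_right hp 1)) with hwdef
  have hsd := Finset.sum_le_sum fun (j : Fin (p + 1)) (_ : j ∈ Finset.univ) => hd j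
  rw [sum_expOne] at hsd
  have hd0 : X ^ (∑ j : Fin (p + 1), psum m j) ∣ w := by
    have := (le_rootMultiplicity_iff hw (a := 0) (n := ∑ j : Fin (p + 1), psum m j)).1 (by omega)
    simpa using this
  have hd1 : (X - 1) ^ (p * k) ∣ w := by
    have := (le_rootMultiplicity_iff hw (a := 1) (n := p * k)).1 (by omega)
    simpa using this
  have hcop : IsCoprime (X ^ (∑ j : Fin (p + 1), psum m j) : ℂ[X]) ((X - 1) ^ (p * k)) :=
    IsCoprime.pow ⟨1, -1, by ring⟩
  obtain ⟨g, hg⟩ := hcop.mul_dvd hd0 hd1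
  refine ⟨g, fun hg0 => ?_, hg⟩
  -- One more factor X would exceed the order at 0 dictated by a_0, …, a_p.
  obtain ⟨g', hg'⟩ := X_dvd_iff.2 ((coeff_zero_eq_eval_zero g).trans hg0)
  have hdvd : (X - C 0) ^ (∑ j : Fin (p + 1), psum m j + 1) ∣ w :=
    ⟨(X - 1) ^ (p * k) * g', by rw [hg, hg', C_0, sub_zero, pow_succ]; ring⟩
  have := (le_rootMultiplicity_iff hw).2 hdvd
  omega

end IsFlagBasis

lemma IsDividedWronskianMultiple.eq_of_monic {p : ℕ} {f f' : Fin (p + 1) → ℂ[X]} {g g' : ℂ[X]}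
    (hr : 0 < r) (hg : g.Monic) (hg' : g'.Monic) (h : IsDividedWronskianMultiple m k f g)
    (h' : IsDividedWronskianMultiple m k f' g')
    (hf : ∀ j, f' j ∈ Submodule.span ℂ (Set.range f)) : g' = g := by
  obtain ⟨c, hc, hgc⟩ := h
  obtain ⟨c', -, hgc'⟩ := h'
  obtain ⟨b, hb⟩ := exists_polyWronskian_eq_C_mul hf
  rw [prod_polyT hr] at hgc hgc'
  have hD : (X ^ (∑ j : Fin (p + 1), psum m j) * (X - 1) ^ (p * k) : ℂ[X]) ≠ 0 :=
    mul_ne_zero (pow_ne_zero _ X_ne_zero) (pow_ne_zero _ (X_sub_C_ne_zero 1))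
  have heq : C c * g' = C (c' * b) * g := by
    refine mul_right_cancel₀ hD ?_
    rw [mul_assoc, mul_assoc, hgc, hgc', hb, C_mul]
    ring
  have hl := congrArg leadingCoeff heq
  rw [leadingCoeff_C_mul_of_isUnit hc.isUnit, hg'.leadingCoeff, leadingCoeff_mul,
    leadingCoeff_C, hg.leadingCoeff, mul_one, mul_one] at hl
  rw [← hl] at heq
  exact mul_left_cancel₀ (C_ne_zero.2 hc) heq

lemma isCoprime_X_sub_C_of_eval_ne_zero {f : ℂ[X]} {z : ℂ} (h : f.eval z ≠ 0) :
    IsCoprime f (X - C z) :=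
  ((irreducible_X_sub_C z).coprime_iff_not_dvd.2 fun hd => h (dvd_iff_isRoot.1 hd)).symm

end Space

/-! ### The main theorem -/

theorem mainTheorem11 (r : ℕ) (hr : 0 < r) (m l : Fin r → ℕ) (k : ℕ)
    (hc : Consistent m l k) :
    ∃ V : Submodule ℂ (Polynomial ℂ),
      IsSpaceV m l k V ∧ (∀ V' : Submodule ℂ (Polynomial ℂ), IsSpaceV m l k V' → V' = V) ∧
      ∃ y : Fin r → Polynomial ℂ,
        IsTupleOf m l k V y ∧ (∀ y' : Fin r → Polynomial ℂ, IsTupleOf m l k V y' → y' = y) ∧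
        (y ⟨0, hr⟩).eval 1 ≠ 0 ∧
        (∀ i : Fin r, (y i).eval 0 ≠ 0) ∧
        ∀ i : Fin r, IsCoprime (y i) (polyT m k i) := by
  obtain ⟨h, H⟩ := exists_isFlagBasis hc
  choose g hg0 hgW using fun i : Fin r => H.polyWronskian_segment hc i.2.le
  have hgne : ∀ i, g i ≠ 0 := fun i hi => hg0 i (by rw [hi, eval_zero])
  have hlc : ∀ i, (g i).leadingCoeff⁻¹ ≠ 0 := fun i =>
    inv_ne_zero (leadingCoeff_ne_zero.2 (hgne i))
  set y : Fin r → ℂ[X] := fun i => g i * C (g i).leadingCoeff⁻¹ with hy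
  have hmonic : ∀ i, (y i).Monic := fun i => monic_mul_leadingCoeff_inv (hgne i)
  have hdiv : ∀ i : Fin r, IsDividedWronskianMultiple m k
      (fun j : Fin ((i : ℕ) + 1) => h (Fin.castLE (Nat.add_le_add_right i.2.le 1) j)) (y i) :=
    fun i => ⟨_, hlc i, by rw [prod_polyT hr, hgW, hy]; ring⟩
  have hy0 : ∀ i, (y i).eval 0 ≠ 0 := fun i => by
    rw [hy, eval_mul, eval_C]
    exact mul_ne_zero (hg0 i) (hlc i)
  have hy1 : (y ⟨0, hr⟩).eval 1 ≠ 0 := by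
    have h1 : polyWronskian (fun j : Fin 1 => h (Fin.castLE (Nat.le_add_left 1 r) j)) = _ :=
      hgW ⟨0, hr⟩
    have h2 := congrArg (eval 1) h1
    simp only [polyWronskian, Matrix.det_unique, Matrix.of_apply, Fin.default_eq_zero,
      Fin.val_zero, Function.iterate_zero, id_eq,
      zero_mul, pow_zero, mul_one, eval_mul, eval_pow, eval_X, one_pow, one_mul] at h2
    rw [hy, eval_mul, eval_C, ← h2]
    exact mul_ne_zero (H.eval_one_ne_zero _) (hlc _)
  have hlin := H.linearIndependent hc
  refine ⟨Submodule.span ℂ (Set.range h), H.isSpaceV hr hc,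
    fun V' hV' => hV'.eq_span hr hc H, y, ⟨Module.Basis.span hlin, fun i => ?_, fun i => ?_⟩,
    fun y' hy' => ?_, hy1, hy0, fun i => ?_⟩
  · rw [Module.Basis.span_apply, isDegreeExponent_iff hc]
    exact H.natDegree_eq i
  · simp only [Module.Basis.span_apply]
    exact ⟨hmonic i, hdiv i⟩
  · obtain ⟨f, hfd, hf⟩ := hy'
    refine funext fun i => ?_
    refine (hdiv i).eq_of_monic hr (hmonic i) (hf i).1 (hf i).2 fun j => ?_
    -- Any basis with the prescribed degrees has its initial segments in the spans of those of h, so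
    -- its Wronskians are proportional to those of h.
    refine H.mem_span_of_natDegree_le hc (f _).2 i.2.le ?_
    rw [(isDegreeExponent_iff hc).1 (hfd _), Fin.val_castLE]
    rcases Nat.lt_or_eq_of_le (Nat.lt_succ_iff.1 j.2) with hj | hj
    · exact (expInfty_lt hc hj i.2.le).le
    · exact (congrArg (expInfty m l k) hj).le
  · have hX : IsCoprime (y i) X := by
      simpa using isCoprime_X_sub_C_of_eval_ne_zero (hy0 i)
    rw [polyT]
    split_ifs with hi
    · have hi' : i = ⟨0, hr⟩ := Fin.ext hi
      refine IsCoprime.mul_right (IsCoprime.pow_right ?_) hX.pow_right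
      rw [hi']
      simpa using isCoprime_X_sub_C_of_eval_ne_zero hy1
    · exact hX.pow_right

end
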